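/- Let $d_{\mathrm{in}}, d_{\mathrm{out}}$ be positive integers and fix the standard ("incoherent") orthonormal bases of $\mathbb{C}^{d_{\mathrm{in}}}$ and $\mathbb{C}^{d_{\mathrm{out}}}$. On either space let $\Delta(A)=\sum_i |i\rangle\langle i|A|i\rangle\langle i|$ be the dephasing map. A channel is a completely positive trace-preserving linear map $\mathcal{E}:M_{d_{\mathrm{in}}}(\mathbb{C})\to M_{d_{\mathrm{out}}}(\mathbb{C})$. A channel $\mathcal{E}$ is - a dephasing-covariant incoherent operation (DIO) if $\Delta\circ\mathcal{E}=\mathcal{E}\circ\Delta$; - an incoherent operation (IO) if it has a finite Kraus representation $\mathcal{E}(A)=\sum_i K_iAK_i^\dagger$ such that, for every $i$, $K_iAK_i^\dagger$ is diagonal whenever $A$ is diagonal; - a strictly incoherent operation (SIO) if it has a finite Kraus representation $\mathcal{E}(A)=\sum_i K_iAK_i^\dagger$ such that $\Delta(K_iAK_i^\dagger)=K_i\Delta(A)K_i^\dagger$ for every $i$ and every $A$. For real vectors $u,v$, the shorter one extended by zeros so that both have length $d$, write $u\prec v$ if $\sum_{i=1}^k u_i^\downarrow\le\sum_{i=1}^k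 v_i^\downarrow$ for all $k=1,\dots,d$, with equality for $k=d$, where $\downarrow$ denotes arrangement in non-increasing order. Let $|\psi\rangle=\sum_x\mu_x|x\rangle\in\mathbb{C}^{d_{\mathrm{in}}}$ and $|\phi\rangle=\sum_y\nu_y|y\rangle\in\mathbb{C}^{d_{\mathrm{out}}}$ be unit vectors, and put $p_x=|\mu_x|^2$, $q_y=|\nu_y|^2$. Then there is a DIO $\mathcal{E}$ with $\mathcal{E}(|\psi\rangle\langle\psi|)=|\phi\rangle\langle\phi|$ if and only if $p\prec q$. Likewise, there is an IO $\mathcal{E}$ with $\mathcal{E}(|\psi\rangle\langle\psi|)=|\phi\rangle\langle\phi|$ if and only if $p\prec q$, and there is an SIO $\mathcal{E}$ with this property if and only if $p\prec q$. Hence DIO, IO and SIO allow exactly the same deterministic transformations between pure states. -/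

import Mathlib

open scoped Matrix ComplexOrder

noncomputable section

namespace Coherence

/-- Operators on the Hilbert space `ℂ^d`, written in the fixed incoherent basis. -/
abbrev Op (d : ℕ) : Type := Matrix (Fin d) (Fin d) ℂ

/-- The rank-one operator `|ψ⟩⟨ψ|`. -/
def proj {d : ℕ} (ψ : EuclideanSpace ℂ (Fin d)) : Op d :=
  Matrix.of fun i j => ψ i * star (ψ j)

/-- The completely dephasing map `Δ`: it keeps the diagonal and erases all other entries. -/
def dephase {d : ℕ} (A : Op d) : Op d := Matrix.diagonal A.diag

/-- The map `id_k ⊗ E`: `E` is applied to every block of a `k × k` block matrix. -/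
def ampliation {m n : ℕ} (k : ℕ) (E : Op m →ₗ[ℂ] Op n)
    (A : Matrix (Fin k × Fin m) (Fin k × Fin m) ℂ) :
    Matrix (Fin k × Fin n) (Fin k × Fin n) ℂ :=
  Matrix.of fun a b => E (Matrix.of fun x x' => A (a.1, x) (b.1, x')) a.2 b.2

/-- Complete positivity: every `id_k ⊗ E` preserves positive semidefiniteness. -/
def IsCompletelyPositive {m n : ℕ} (E : Op m →ₗ[ℂ] Op n) : Prop :=
  ∀ (k : ℕ) (A : Matrix (Fin k × Fin m) (Fin k × Fin m) ℂ),
    A.PosSemidef → (ampliation k E A).PosSemidef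

/-- A quantum channel: a completely positive and trace-preserving linear map. -/
structure IsChannel {m n : ℕ} (E : Op m →ₗ[ℂ] Op n) : Prop where
  completelyPositive : IsCompletelyPositive E
  tracePreserving : ∀ A, (E A).trace = A.trace

/-- `K` is a (finite) family of Kraus operators of `E`. -/
def IsKraus {m n r : ℕ} (E : Op m →ₗ[ℂ] Op n) (K : Fin r → Matrix (Fin n) (Fin m) ℂ) : Prop :=
  ∀ A, E A = ∑ i, K i * A * (K i)ᴴ

/-- Dephasing-covariant incoherent operations: channels that commute with dephasing. -/
structure IsDIO {m n : ℕ} (E : Op m →ₗ[ℂ] Op n) : Prop where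
  channel : IsChannel E
  covariant : ∀ A, dephase (E A) = E (dephase A)

/-- Incoherent operations: channels with a Kraus representation each of whose Kraus operators
maps diagonal operators to diagonal operators. -/
structure IsIO {m n : ℕ} (E : Op m →ₗ[ℂ] Op n) : Prop where
  channel : IsChannel E
  incoherent : ∃ (r : ℕ) (K : Fin r → Matrix (Fin n) (Fin m) ℂ), IsKraus E K ∧
    ∀ i (A : Op m), A.IsDiag → (K i * A * (K i)ᴴ).IsDiag

/-- Strictly incoherent operations: channels with a Kraus representation each of whose Kraus
operators commutes with dephasing. -/
structure IsSIO {m n : ℕ} (E : Op m →ₗ[ℂ] Op n) : Prop where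
  channel : IsChannel E
  strictlyIncoherent : ∃ (r : ℕ) (K : Fin r → Matrix (Fin n) (Fin m) ℂ), IsKraus E K ∧
    ∀ i (A : Op m), dephase (K i * A * (K i)ᴴ) = K i * dephase A * (K i)ᴴ

/-- The vector `u` extended by trailing zeros to length `d` (used with `m ≤ d`). -/
def zeroPad {m : ℕ} (d : ℕ) (u : Fin m → ℝ) : Fin d → ℝ :=
  fun i => if h : (i : ℕ) < m then u ⟨i, h⟩ else 0

/-- The components of `u` in non-increasing order. -/
def sortDesc {d : ℕ} (u : Fin d → ℝ) : Fin d → ℝ :=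
  fun i => u (Tuple.sort u i.rev)

theorem sortDesc_antitone {d : ℕ} (u : Fin d → ℝ) : Antitone (sortDesc u) :=
  fun _ _ h => Tuple.monotone_sort u (Fin.rev_le_rev.mpr h)

/-- The sum of the `k` largest components of `u`. -/
def topSum {d : ℕ} (u : Fin d → ℝ) (k : ℕ) : ℝ :=
  ∑ i ∈ Finset.univ.filter (fun i : Fin d => i.val < k), sortDesc u i

/-- Majorization `u ≺ v`; the shorter vector is first extended by zeros. -/
def MajorizedBy {m n : ℕ} (u : Fin m → ℝ) (v : Fin n → ℝ) : Prop :=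
  (∀ k ≤ max m n, topSum (zeroPad (max m n) u) k ≤ topSum (zeroPad (max m n) v) k) ∧
    ∑ i, u i = ∑ j, v j

end Coherence

end

namespace Coherence

/-! Sufficiency: if p ≺ q, then p is a convex combination ∑ lᵢ (q ∘ σᵢ) of rearrangements of q
(`mem_convexHull_of_topSum_le`). The operators √lᵢ ∑ₓ (φ_{σᵢ x}/ψₓ)|σᵢ x⟩⟨x| send ψ to √lᵢ φ and
have at most one nonzero entry per row and column. They therefore give an SIO, which is both an IO
and a DIO.

Necessity: by `majorizedBy_of_weights` it is enough to cover each sum of p over a set S by a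
weighted sum of q, with weights in [0,1] of total at most |S|. For a DIO, the Choi matrix is the
Gram matrix of vectors v x y, and covariance makes these orthogonal when exactly one index changes.
The matrix t x y = ‖v x y‖² is stochastic and maps p to q. Purity of the output puts the vectors ∑ₓ
ψ̄ₓ v x y on one line, and a Bessel-type bound against that line gives ∑_y pₓ t x y / q_y ≤ 1. These
reversed rows, summed over S, are the weights. For an IO, each Kraus operator Kᵢ sends S into a set
Tᵢ of at most |S| rows, and Kᵢψ = c̄ᵢφ. Cauchy–Schwarz for ψ truncated to S shows that the
|cᵢ|²-average of the indicators of Tᵢ works. -/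

/-! ### Zero padding and sums of largest components -/

theorem sum_mul_zeroPad {m d : ℕ} (h : m ≤ d) (f : Fin d → ℝ) (u : Fin m → ℝ) :
    ∑ i, f i * zeroPad d u i = ∑ x, f (Fin.castLE h x) * u x := by
  have h1 : ∑ x, f (Fin.castLE h x) * u x =
      ∑ i ∈ Finset.univ.map (Fin.castLEEmb h), f i * zeroPad d u i := by
    rw [Finset.sum_map]
    refine Finset.sum_congr rfl fun x _ => ?_
    simp [zeroPad]
  rw [h1]
  symm
  refine Finset.sum_subset (Finset.subset_univ _) fun i _ hi => ?_
  have : ¬ (i : ℕ) < m := fun hlt => hi (by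
    simp only [Finset.mem_map, Finset.mem_univ, true_and]
    exact ⟨⟨i, hlt⟩, rfl⟩)
  simp [zeroPad, this]

theorem sum_zeroPad {m d : ℕ} (h : m ≤ d) (u : Fin m → ℝ) :
    ∑ i, zeroPad d u i = ∑ x, u x := by
  simpa using sum_mul_zeroPad h (fun _ => 1) u

theorem zeroPad_castLE {m d : ℕ} (h : m ≤ d) (u : Fin m → ℝ) (x : Fin m) :
    zeroPad d u (Fin.castLE h x) = u x := by
  simp [zeroPad]

theorem zeroPad_mem {m d : ℕ} {u : Fin m → ℝ} {s : Set ℝ} (h0 : (0 : ℝ) ∈ s)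
    (hu : ∀ x, u x ∈ s) (i : Fin d) : zeroPad d u i ∈ s := by
  unfold zeroPad
  split
  · exact hu _
  · exact h0

/-- The permutation that arranges `u` in non-increasing order. -/
noncomputable def sortPerm {d : ℕ} (u : Fin d → ℝ) : Equiv.Perm (Fin d) := Fin.revPerm.trans (Tuple.sort u)

theorem sortDesc_apply {d : ℕ} (u : Fin d → ℝ) (i : Fin d) : sortDesc u i = u (sortPerm u i) := rfl

theorem card_filter_val_lt_le (d k : ℕ) :
    (Finset.univ.filter (fun i : Fin d => i.val < k)).card ≤ k := by
  rw [Fin.card_filter_val_lt]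
  exact min_le_right _ _

theorem card_filter_val_lt_of_le {d k : ℕ} (h : k ≤ d) :
    (Finset.univ.filter (fun i : Fin d => i.val < k)).card = k := by
  rw [Fin.card_filter_val_lt]
  exact min_eq_right h

theorem exists_finset_topSum_eq {d : ℕ} (u : Fin d → ℝ) (k : ℕ) :
    ∃ S : Finset (Fin d), S.card ≤ k ∧ topSum u k = ∑ i ∈ S, u i := by
  refine ⟨(Finset.univ.filter (fun i : Fin d => i.val < k)).map (sortPerm u).toEmbedding, ?_, ?_⟩
  · rw [Finset.card_map]
    exact card_filter_val_lt_le d k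
  · rw [Finset.sum_map]
    rfl

/-- The sum of the `k` largest components dominates every weighted sum with weights in `[0, 1]`
of total weight at most `k`, provided that `u` is nonnegative or the total weight is `k`. -/
theorem sum_mul_le_topSum {d k : ℕ} (hk : k ≤ d) (u w : Fin d → ℝ)
    (h0 : ∀ i, 0 ≤ w i) (h1 : ∀ i, w i ≤ 1)
    (hs : (∑ i, w i ≤ k ∧ ∀ i, 0 ≤ u i) ∨ ∑ i, w i = k) :
    ∑ i, w i * u i ≤ topSum u k := by
  have hle : ∑ i, w i ≤ k := hs.elim (fun h => h.1) (fun h => h.le)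
  rcases Nat.eq_zero_or_pos k with rfl | hpos
  · have hw : ∀ i, w i = 0 := by
      have : ∑ i, w i = 0 := le_antisymm (by simpa using hle) (Finset.sum_nonneg fun i _ => h0 i)
      intro i
      exact (Finset.sum_eq_zero_iff_of_nonneg fun i _ => h0 i).1 this i (Finset.mem_univ i)
    simp [hw, topSum]
  set e := sortPerm u
  have hre : ∀ f : Fin d → ℝ, ∑ i, f i = ∑ i, f (e i) := fun f => (Equiv.sum_comp e f).symm
  rw [hre] at hle hs
  rw [hre]
  -- The threshold `t` is the k-th largest component. Replacing `w` by the indicator of the first k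
  -- positions moves weight from components at most `t` to components at least `t`.
  set t := sortDesc u ⟨k - 1, by omega⟩
  have hpt : ∀ i : Fin d,
      0 ≤ ((if i.val < k then 1 else 0) - w (e i)) * (sortDesc u i - t) := by
    intro i
    split_ifs with hi
    · refine mul_nonneg (sub_nonneg.2 (h1 _)) (sub_nonneg.2 (sortDesc_antitone u ?_))
      show i.val ≤ k - 1
      omega
    · refine mul_nonneg_of_nonpos_of_nonpos (by linarith [h0 (e i)])
        (sub_nonpos.2 (sortDesc_antitone u ?_))
      show k - 1 ≤ i.val
      omega
  have hsum := Finset.sum_nonneg fun i (_ : i ∈ Finset.univ) => hpt i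
  have hcard : ∑ i : Fin d, (if i.val < k then (1 : ℝ) else 0) = k := by
    rw [Finset.sum_boole, card_filter_val_lt_of_le hk]
  have htop : topSum u k = ∑ i : Fin d, (if i.val < k then (1 : ℝ) else 0) * sortDesc u i := by
    simp [topSum, Finset.sum_filter]
  have hexp : ∑ i : Fin d, ((if i.val < k then (1 : ℝ) else 0) - w (e i)) * (sortDesc u i - t) =
      topSum u k - ∑ i, w (e i) * u (e i) - t * (k - ∑ i, w (e i)) := by
    rw [htop, ← hcard, mul_sub, Finset.mul_sum, Finset.mul_sum, ← Finset.sum_sub_distrib,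
      ← Finset.sum_sub_distrib, ← Finset.sum_sub_distrib]
    refine Finset.sum_congr rfl fun i _ => ?_
    rw [sortDesc_apply u i]
    ring
  rw [hexp] at hsum
  have ht : 0 ≤ t * (k - ∑ i, w (e i)) := by
    rcases hs with ⟨h, hu⟩ | h
    · exact mul_nonneg (hu _) (sub_nonneg.2 h)
    · rw [h]; simp
  linarith

/-- A sufficient criterion for majorization of nonnegative vectors in terms of weights. -/
theorem majorizedBy_of_weights {m n : ℕ} {p : Fin m → ℝ} {q : Fin n → ℝ}
    (hq : ∀ y, 0 ≤ q y) (hpq : ∑ x, p x = ∑ y, q y)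
    (H : ∀ S : Finset (Fin m), ∃ w : Fin n → ℝ, (∀ y, 0 ≤ w y) ∧ (∀ y, w y ≤ 1) ∧
      ∑ y, w y ≤ S.card ∧ ∑ x ∈ S, p x ≤ ∑ y, w y * q y) :
    MajorizedBy p q := by
  refine ⟨fun k hk => ?_, hpq⟩
  set d := max m n
  have hm : m ≤ d := le_max_left m n
  have hn : n ≤ d := le_max_right m n
  obtain ⟨T, hTk, hT⟩ := exists_finset_topSum_eq (zeroPad d p) k
  -- Members of `T` beyond `m` are padding and contribute zero, so the total weight may fall short
  -- of `k`; nonnegativity of `q` absorbs this.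
  set S : Finset (Fin m) := Finset.univ.filter (fun x => Fin.castLE hm x ∈ T)
  have hS : S.card ≤ k := by
    refine le_trans ?_ hTk
    rw [← Finset.card_map (Fin.castLEEmb hm)]
    refine Finset.card_le_card fun i hi => ?_
    obtain ⟨x, hx, rfl⟩ := Finset.mem_map.1 hi
    exact (Finset.mem_filter.1 hx).2
  have hTS : topSum (zeroPad d p) k = ∑ x ∈ S, p x := by
    have := sum_mul_zeroPad hm (fun i => if i ∈ T then 1 else 0) p
    simp only [ite_mul, one_mul, zero_mul, Finset.sum_ite_mem, Finset.univ_inter] at this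
    rw [hT, this, Finset.sum_filter]
  obtain ⟨w, hw0, hw1, hws, hw⟩ := H S
  have hfin := sum_mul_le_topSum hk (zeroPad d q) (zeroPad d w)
    (zeroPad_mem (s := Set.Ici 0) (by simp) hw0)
    (zeroPad_mem (s := Set.Iic 1) (by simp) hw1)
    (Or.inl ⟨by rw [sum_zeroPad hn]; exact hws.trans (by exact_mod_cast hS),
      zeroPad_mem (s := Set.Ici 0) (by simp) hq⟩)
  rw [sum_mul_zeroPad hn] at hfin
  simp only [zeroPad_castLE] at hfin
  rw [hTS]
  exact hw.trans hfin

theorem sum_le_topSum {d : ℕ} (u : Fin d → ℝ) (S : Finset (Fin d)) :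
    ∑ i ∈ S, u i ≤ topSum u S.card := by
  have := sum_mul_le_topSum (k := S.card) (by simpa using S.card_le_univ) u
    (fun i => if i ∈ S then 1 else 0) (fun i => by split_ifs <;> simp)
    (fun i => by split_ifs <;> simp) (Or.inr (by simp))
  simpa using this

/-! ### Majorization and convex hulls of rearrangements -/

/-- Abel summation by induction. The last coefficient stays on the left because `c` may be negative;
it disappears once the total of `a` is zero. -/
theorem mul_sum_range_le_sum_range_mul (c a : ℕ → ℝ) (n : ℕ)
    (hc : ∀ i j, i ≤ j → j < n → c j ≤ c i) (ha : ∀ k ≤ n, 0 ≤ ∑ i ∈ Finset.range k, a i) :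
    c (n - 1) * ∑ i ∈ Finset.range n, a i ≤ ∑ i ∈ Finset.range n, c i * a i := by
  induction n with
  | zero => simp
  | succ n ih =>
    have h := ih (fun i j hij hj => hc i j hij (by omega)) (fun k hk => ha k (by omega))
    have h2 := mul_le_mul_of_nonneg_right (hc (n - 1) n (by omega) (by omega)) (ha n (by omega))
    rw [Finset.sum_range_succ, Finset.sum_range_succ, Nat.add_sub_cancel, mul_add]
    linarith

theorem sum_mul_nonneg_of_antitone {d : ℕ} (c a : Fin d → ℝ) (hc : Antitone c)
    (ha : ∀ k ≤ d, 0 ≤ ∑ i ∈ Finset.univ.filter (fun i : Fin d => i.val < k), a i)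
    (h0 : ∑ i, a i = 0) : 0 ≤ ∑ i, c i * a i := by
  set c' : ℕ → ℝ := fun i => if h : i < d then c ⟨i, h⟩ else 0 with hc'
  set a' : ℕ → ℝ := fun i => if h : i < d then a ⟨i, h⟩ else 0 with ha'
  have hcf : ∀ i : Fin d, c i = c' i := fun i => by simp [hc']
  have haf : ∀ i : Fin d, a i = a' i := fun i => by simp [ha']
  have hpart : ∀ k ≤ d, ∑ i ∈ Finset.univ.filter (fun i : Fin d => i.val < k), a i =
      ∑ i ∈ Finset.range k, a' i := by
    intro k hk
    simp_rw [haf]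
    rw [Finset.sum_filter, Fin.sum_univ_eq_sum_range (fun i => if i < k then a' i else 0),
      ← Finset.sum_filter]
    congr 1
    ext i
    simp only [Finset.mem_filter, Finset.mem_range]
    omega
  have hmain := mul_sum_range_le_sum_range_mul c' a' d
    (fun i j hij hj => by
      simp only [hc', hj, lt_of_le_of_lt hij hj, dif_pos]
      exact hc hij)
    (fun k hk => by rw [← hpart k hk]; exact ha k hk)
  simp_rw [haf] at h0
  rw [Fin.sum_univ_eq_sum_range a'] at h0
  simp_rw [hcf, haf]
  rw [Fin.sum_univ_eq_sum_range (fun i => c' i * a' i)]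
  rw [h0, mul_zero] at hmain
  exact hmain

/-- A vector majorized by `q` is a convex combination of rearrangements of `q`. -/
theorem mem_convexHull_of_topSum_le {d : ℕ} {p q : Fin d → ℝ}
    (h : ∀ k ≤ d, topSum p k ≤ topSum q k) (hs : ∑ i, p i = ∑ i, q i) :
    p ∈ convexHull ℝ (Set.range fun σ : Equiv.Perm (Fin d) => q ∘ σ) := by
  by_contra hp
  obtain ⟨f, s, hf, hfp⟩ := geometric_hahn_banach_closed_point (convex_convexHull ℝ _)
    ((Set.finite_range fun σ : Equiv.Perm (Fin d) => q ∘ σ).isClosed_convexHull ℝ) hp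
  set c : Fin d → ℝ := fun i => f (Pi.single i 1)
  have hfc : ∀ u : Fin d → ℝ, f u = ∑ i, c i * u i := by
    intro u
    conv_lhs => rw [pi_eq_sum_univ' u, map_sum]
    refine Finset.sum_congr rfl fun i _ => ?_
    rw [map_smul, smul_eq_mul, mul_comm]
  set τ := sortPerm c
  set ρ := sortPerm q
  -- The rearrangement of `q` ordered like the coefficients `c` maximizes the separating functional,
  -- and its value there is at least that at `p`: a contradiction.
  have hq := hf _ (subset_convexHull ℝ _ ⟨τ.symm.trans ρ, rfl⟩)
  rw [hfc, ← Equiv.sum_comp τ] at hq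
  rw [hfc, ← Equiv.sum_comp τ] at hfp
  have hkey := sum_mul_nonneg_of_antitone (sortDesc c) (fun i => sortDesc q i - p (τ i))
    (sortDesc_antitone c) (fun k hk => by
      rw [Finset.sum_sub_distrib, sub_nonneg]
      have h1 := sum_le_topSum p
        ((Finset.univ.filter (fun i : Fin d => i.val < k)).map τ.toEmbedding)
      rw [Finset.card_map, card_filter_val_lt_of_le hk, Finset.sum_map] at h1
      exact h1.trans (h k hk))
    (by
      rw [Finset.sum_sub_distrib, Equiv.sum_comp τ p, hs, sub_eq_zero]
      exact Equiv.sum_comp ρ q)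
  simp only [mul_sub, Finset.sum_sub_distrib, sortDesc_apply] at hkey
  simp only [Function.comp_apply, Equiv.trans_apply, Equiv.symm_apply_apply] at hq
  linarith

theorem MajorizedBy.exists_perm_combination {m n : ℕ} {p : Fin m → ℝ} {q : Fin n → ℝ}
    (h : MajorizedBy p q) :
    ∃ (ι : Type) (_ : Fintype ι) (l : ι → ℝ) (σ : ι → Equiv.Perm (Fin (max m n))),
      (∀ i, 0 ≤ l i) ∧ ∑ i, l i = 1 ∧
      ∀ x, zeroPad (max m n) p x = ∑ i, l i * zeroPad (max m n) q (σ i x) := by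
  have hmem := mem_convexHull_of_topSum_le h.1
    (by rw [sum_zeroPad (le_max_left m n), sum_zeroPad (le_max_right m n), h.2])
  obtain ⟨ι, hι, l, z, hl0, hl1, hz, hp⟩ := mem_convexHull_iff_exists_fintype.1 hmem
  choose σ hσ using hz
  refine ⟨ι, hι, l, σ, hl0, hl1, fun x => ?_⟩
  rw [← hp, Finset.sum_apply]
  refine Finset.sum_congr rfl fun i _ => ?_
  rw [← hσ i]
  rfl

/-! ### Gram vectors and necessity for DIO -/

/-- The Choi matrix of a completely positive map is a Gram matrix. -/
theorem IsCompletelyPositive.exists_gram {m n : ℕ} {E : Op m →ₗ[ℂ] Op n}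
    (hE : IsCompletelyPositive E) :
    ∃ (r : ℕ) (v : Fin m → Fin n → EuclideanSpace ℂ (Fin r)),
      ∀ x x' y y', E (Matrix.single x x' 1) y y' = inner ℂ (v x y) (v x' y') := by
  -- The unnormalized maximally entangled vector: block (x, x') of its projector is |x⟩⟨x'|.
  set a : Fin m × Fin m → ℂ := fun i => if i.1 = i.2 then 1 else 0
  obtain ⟨r, v, hv⟩ := Matrix.posSemidef_iff_eq_sum_vecMulVec.1
    (hE m _ (Matrix.posSemidef_vecMulVec_self_star a))
  refine ⟨r, fun x y => WithLp.toLp 2 fun i => star (v i (x, y)), fun x x' y y' => ?_⟩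
  have h := congrFun (congrFun hv (x, y)) (x', y')
  have hs : (Matrix.of fun z z' => Matrix.vecMulVec a (star a) (x, z) (x', z')) =
      Matrix.single x x' (1 : ℂ) := by
    ext z z'
    by_cases h1 : x = z <;> by_cases h2 : x' = z' <;>
      simp [Matrix.vecMulVec_apply, a, h1, h2]
  simp only [ampliation, Matrix.of_apply, hs] at h
  rw [h, Matrix.sum_apply, PiLp.inner_apply]
  refine Finset.sum_congr rfl fun i _ => ?_
  simp [Matrix.vecMulVec_apply, mul_comm]

theorem apply_eq_sum_single {m n : ℕ} (E : Op m →ₗ[ℂ] Op n) (A : Op m) (y y' : Fin n) :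
    E A y y' = ∑ x, ∑ x', A x x' * E (Matrix.single x x' 1) y y' := by
  conv_lhs => rw [Matrix.matrix_eq_sum_single A]
  simp only [map_sum, Matrix.sum_apply]
  refine Finset.sum_congr rfl fun x _ => Finset.sum_congr rfl fun x' _ => ?_
  rw [← mul_one (A x x'), ← smul_eq_mul (A x x') 1, ← Matrix.smul_single, map_smul]
  simp

theorem inner_self_eq_ofReal_norm_sq {V : Type*} [NormedAddCommGroup V] [InnerProductSpace ℂ V]
    (v : V) : inner ℂ v v = ((‖v‖ ^ 2 : ℝ) : ℂ) := by
  rw [inner_self_eq_norm_sq_to_K]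
  push_cast
  rfl

theorem mul_star_eq_ofReal_norm_sq (z : ℂ) : z * star z = ((‖z‖ ^ 2 : ℝ) : ℂ) := by
  rw [Complex.star_def, Complex.mul_conj, Complex.normSq_eq_norm_sq]

theorem star_mul_eq_ofReal_norm_sq (z : ℂ) : star z * z = ((‖z‖ ^ 2 : ℝ) : ℂ) := by
  rw [mul_comm, mul_star_eq_ofReal_norm_sq]

/-- A family with a rank-one Gram matrix lies on a line. -/
theorem exists_unit_of_gram_rank_one {ι V : Type*} [NormedAddCommGroup V] [InnerProductSpace ℂ V]
    (w : ι → V) (a : ι → ℂ) (h : ∀ i j, inner ℂ (w i) (w j) = a i * star (a j))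
    {i₀ : ι} (hi₀ : a i₀ ≠ 0) :
    ∃ c : V, ‖c‖ = 1 ∧ ∀ i, w i = star (a i) • c := by
  obtain ⟨c, hc⟩ : ∃ c : V, c = (star (a i₀))⁻¹ • w i₀ := ⟨_, rfl⟩
  have h0 : star (a i₀) ≠ 0 := star_ne_zero.2 hi₀
  have hcw : ∀ j, inner ℂ c (w j) = star (a j) := by
    intro j
    rw [hc, inner_smul_left, h]
    simp [hi₀]
  have hcc : inner ℂ c c = (1 : ℂ) := by
    conv_lhs => enter [3]; rw [hc]
    rw [inner_smul_right, hcw, inv_mul_cancel₀ h0]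
  refine ⟨c, ?_, fun i => ?_⟩
  · rw [inner_self_eq_ofReal_norm_sq] at hcc
    have : ‖c‖ ^ 2 = 1 := by exact_mod_cast hcc
    nlinarith [norm_nonneg c]
  · have hwc : inner ℂ (w i) c = a i := by
      rw [← inner_conj_symm, hcw]
      simp
    -- The squared norm of `w i - star (a i) • c` expands to zero.
    rw [← sub_eq_zero, ← inner_self_eq_zero (𝕜 := ℂ), inner_sub_left, inner_sub_right,
      inner_sub_right, inner_smul_left, inner_smul_left, inner_smul_right, inner_smul_right,
      hwc, hcw, hcc, h]
    simp [mul_comm]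

/-- A form of Bessel's inequality: u = ∑ aᵢvᵢ satisfies ⟨u,u⟩ = ⟨u,c⟩ = s, so s = ‖u‖² ≤ ‖u‖ and s ≤
1. -/
theorem sum_norm_sq_mul_le_one {ι V : Type*} [Fintype ι] [NormedAddCommGroup V]
    [InnerProductSpace ℂ V] (v : ι → V) (a : ι → ℂ) (c : V) (hc : ‖c‖ = 1)
    (horth : ∀ i j, i ≠ j → inner ℂ (v i) (v j) = 0)
    (h : ∀ i, a i ≠ 0 → inner ℂ (v i) c = a i * (‖v i‖ ^ 2 : ℝ)) :
    ∑ i, ‖a i‖ ^ 2 * ‖v i‖ ^ 2 ≤ 1 := by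
  set u := ∑ i, a i • v i with hu
  set s := ∑ i, ‖a i‖ ^ 2 * ‖v i‖ ^ 2 with hs
  have huc : inner ℂ u c = (s : ℂ) := by
    rw [hu, sum_inner, hs, Complex.ofReal_sum]
    refine Finset.sum_congr rfl fun i _ => ?_
    rw [inner_smul_left]
    by_cases hi : a i = 0
    · simp [hi]
    · rw [h i hi, ← mul_assoc, ← Complex.star_def, star_mul_eq_ofReal_norm_sq, ← Complex.ofReal_mul]
  have huu : inner ℂ u u = (s : ℂ) := by
    conv_lhs => enter [2]; rw [hu]
    rw [sum_inner, hs, Complex.ofReal_sum]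
    refine Finset.sum_congr rfl fun i _ => ?_
    rw [inner_smul_left, hu, inner_sum, Finset.sum_eq_single i]
    · rw [inner_smul_right, ← mul_assoc, ← Complex.star_def, star_mul_eq_ofReal_norm_sq,
        inner_self_eq_ofReal_norm_sq, ← Complex.ofReal_mul]
    · intro j _ hj
      rw [inner_smul_right, horth i j hj.symm, mul_zero]
    · simp
  have hsu : s = ‖u‖ ^ 2 := by
    rw [inner_self_eq_ofReal_norm_sq] at huu
    exact_mod_cast huu.symm
  have hle : s ≤ ‖u‖ := by
    have := norm_inner_le_norm (𝕜 := ℂ) u c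
    rw [huc, hc, mul_one, Complex.norm_real] at this
    exact (le_abs_self s).trans this
  nlinarith [norm_nonneg u]

theorem sum_norm_sq_eq_one {d : ℕ} {ψ : EuclideanSpace ℂ (Fin d)} (h : ‖ψ‖ = 1) :
    ∑ x, ‖ψ x‖ ^ 2 = 1 := by
  rw [← EuclideanSpace.norm_sq_eq, h, one_pow]

theorem exists_ne_zero_of_norm_eq_one {d : ℕ} {ψ : EuclideanSpace ℂ (Fin d)} (h : ‖ψ‖ = 1) :
    ∃ x, ψ x ≠ 0 := by
  by_contra! h0
  have := sum_norm_sq_eq_one h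
  simp [h0] at this

/-- If a stochastic matrix `t` maps `p` to `q` and the rows of the reversed matrix
`p x * t x y / q y` have sum at most one, then `p` is majorized by `q`. -/
theorem majorizedBy_of_stochastic {m n : ℕ} {p : Fin m → ℝ} {q : Fin n → ℝ}
    {t : Fin m → Fin n → ℝ} (hp : ∀ x, 0 ≤ p x) (ht : ∀ x y, 0 ≤ t x y)
    (hsum : ∀ x, ∑ y, t x y = 1) (hpq : ∀ y, ∑ x, p x * t x y = q y)
    (hrev : ∀ x, ∑ y, p x * t x y / q y ≤ 1) : MajorizedBy p q := by
  have hpt : ∀ x y, 0 ≤ p x * t x y := fun x y => mul_nonneg (hp x) (ht x y)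
  have hq : ∀ y, 0 ≤ q y := fun y => by
    rw [← hpq]
    exact Finset.sum_nonneg fun x _ => hpt x y
  have hrow : ∀ x, ∑ y, p x * t x y = p x := fun x => by rw [← Finset.mul_sum, hsum, mul_one]
  refine majorizedBy_of_weights hq ?_ fun S => ?_
  · simp only [← hpq]
    rw [Finset.sum_comm]
    simp only [hrow]
  refine ⟨fun y => ∑ x ∈ S, p x * t x y / q y,
    fun y => Finset.sum_nonneg fun x _ => div_nonneg (hpt x y) (hq y), fun y => ?_, ?_,
    le_of_eq ?_⟩
  · beta_reduce
    rw [← Finset.sum_div]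
    refine div_le_one_of_le₀ ?_ (hq y)
    rw [← hpq y]
    exact Finset.sum_le_univ_sum_of_nonneg fun x => hpt x y
  · rw [Finset.sum_comm]
    refine (Finset.sum_le_sum fun x _ => hrev x).trans ?_
    simp
  · simp only [Finset.sum_mul]
    rw [Finset.sum_comm]
    refine Finset.sum_congr rfl fun x _ => ?_
    refine (hrow x).symm.trans (Finset.sum_congr rfl fun y _ => ?_)
    -- If q y = 0, every p x * t x y vanishes, so division by zero loses nothing.
    by_cases h0 : q y = 0
    · have h2 := hpq y
      rw [h0, Finset.sum_eq_zero_iff_of_nonneg fun x _ => hpt x y] at h2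
      rw [h2 x (Finset.mem_univ x), zero_div, zero_mul]
    · rw [div_mul_cancel₀ _ h0]

theorem IsDIO.majorizedBy {m n : ℕ} {E : Op m →ₗ[ℂ] Op n} (hE : IsDIO E)
    {ψ : EuclideanSpace ℂ (Fin m)} {φ : EuclideanSpace ℂ (Fin n)}
    (hφ : ‖φ‖ = 1) (h : E (proj ψ) = proj φ) :
    MajorizedBy (fun x => ‖ψ x‖ ^ 2) (fun y => ‖φ y‖ ^ 2) := by
  obtain ⟨r, v, hv⟩ := hE.channel.completelyPositive.exists_gram
  -- Dephasing kills |x⟩⟨x'| for x ≠ x', so its image has zero diagonal; below, it fixes |x⟩⟨x|, so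
  -- that image is diagonal.
  have hrow : ∀ y x x', x ≠ x' → inner ℂ (v x y) (v x' y) = 0 := by
    intro y x x' hx
    have h1 := congrFun (congrFun (hE.covariant (Matrix.single x x' 1)) y) y
    have h2 : dephase (Matrix.single x x' (1 : ℂ)) = 0 := by
      ext i j
      rw [dephase, Matrix.diagonal_apply]
      split_ifs with hij
      · simp only [Matrix.diag_apply, Matrix.single_apply, Matrix.zero_apply]
        exact if_neg fun hh => hx (hh.1.trans hh.2.symm)
      · rfl
    rw [h2, map_zero] at h1
    simpa [dephase, hv] using h1
  have hcol : ∀ x y y', y ≠ y' → inner ℂ (v x y) (v x y') = 0 := by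
    intro x y y' hy
    have h1 := congrFun (congrFun (hE.covariant (Matrix.single x x 1)) y) y'
    have h2 : dephase (Matrix.single x x (1 : ℂ)) = Matrix.single x x 1 := by
      ext i j
      simp only [dephase, Matrix.diagonal_apply, Matrix.diag_apply, Matrix.single_apply]
      grind
    rw [h2, hv, dephase, Matrix.diagonal_apply_ne _ hy] at h1
    exact h1.symm
  have htr : ∀ x, ∑ y, ‖v x y‖ ^ 2 = 1 := by
    intro x
    have h1 := hE.channel.tracePreserving (Matrix.single x x 1)
    rw [Matrix.trace_single_eq_same, Matrix.trace] at h1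
    simp only [Matrix.diag_apply, hv, inner_self_eq_ofReal_norm_sq] at h1
    exact_mod_cast h1
  -- The Gram matrix of `w` is E(|ψ⟩⟨ψ|), hence of rank one.
  set w : Fin n → EuclideanSpace ℂ (Fin r) := fun y => ∑ x, star (ψ x) • v x y with hw
  have hww : ∀ y y', inner ℂ (w y) (w y') = φ y * star (φ y') := by
    intro y y'
    have h1 : E (proj ψ) y y' = φ y * star (φ y') := by rw [h]; rfl
    rw [← h1, apply_eq_sum_single, hw, sum_inner]
    refine Finset.sum_congr rfl fun x _ => ?_
    rw [inner_sum]
    refine Finset.sum_congr rfl fun x' _ => ?_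
    rw [inner_smul_left, inner_smul_right, hv]
    simp [proj, mul_assoc]
  have hvw : ∀ x y, inner ℂ (v x y) (w y) = star (ψ x) * (‖v x y‖ ^ 2 : ℝ) := by
    intro x y
    rw [hw, inner_sum, Finset.sum_eq_single x]
    · rw [inner_smul_right, inner_self_eq_ofReal_norm_sq]
    · intro x' _ hx'
      rw [inner_smul_right, hrow y x x' hx'.symm, mul_zero]
    · simp
  have hq : ∀ y, ∑ x, ‖ψ x‖ ^ 2 * ‖v x y‖ ^ 2 = ‖φ y‖ ^ 2 := by
    intro y
    have h1 := hww y y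
    conv_lhs at h1 => enter [2]; rw [hw]
    rw [sum_inner] at h1
    rw [mul_star_eq_ofReal_norm_sq] at h1
    simp only [inner_smul_left, hvw, ← mul_assoc, ← Complex.star_def, star_star,
      mul_star_eq_ofReal_norm_sq] at h1
    exact_mod_cast h1
  obtain ⟨y₀, hy₀⟩ := exists_ne_zero_of_norm_eq_one hφ
  obtain ⟨c, hc, hwc⟩ := exists_unit_of_gram_rank_one w φ hww hy₀
  have hbessel : ∀ x, ∑ y, ‖ψ x‖ ^ 2 * ‖v x y‖ ^ 2 / ‖φ y‖ ^ 2 ≤ 1 := by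
    intro x
    have h1 := sum_norm_sq_mul_le_one (v x) (fun y => star (ψ x) / star (φ y)) c hc (hcol x) (by
      intro y hy
      have hφy : star (φ y) ≠ 0 := fun h0 => hy (by simp only [h0, div_zero])
      have h2 := hvw x y
      rw [hwc, inner_smul_right] at h2
      rw [div_mul_eq_mul_div, ← h2, mul_div_cancel_left₀ _ hφy])
    refine le_trans (le_of_eq (Finset.sum_congr rfl fun y _ => ?_)) h1
    rw [norm_div, norm_star, norm_star, div_pow]
    ring
  exact majorizedBy_of_stochastic (fun x => sq_nonneg _) (fun x y => sq_nonneg _) htr hq hbessel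

/-! ### Kraus operators and necessity for IO -/

theorem mul_vecMulVec_mul_conjTranspose {m n : ℕ} (K : Matrix (Fin n) (Fin m) ℂ)
    (a b : Fin m → ℂ) :
    K * Matrix.vecMulVec a (star b) * Kᴴ = Matrix.vecMulVec (K *ᵥ a) (star (K *ᵥ b)) := by
  rw [Matrix.mul_vecMulVec, Matrix.vecMulVec_mul, Matrix.star_mulVec]

theorem proj_eq_vecMulVec {d : ℕ} (ψ : EuclideanSpace ℂ (Fin d)) :
    proj ψ = Matrix.vecMulVec ψ.ofLp (star ψ.ofLp) := rfl

/-- Trace preservation tested on |a⟩⟨b|: the Kraus family is jointly an isometry. -/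
theorem IsKraus.sum_mulVec {m n r : ℕ} {E : Op m →ₗ[ℂ] Op n}
    {K : Fin r → Matrix (Fin n) (Fin m) ℂ} (hK : IsKraus E K)
    (hE : ∀ A, (E A).trace = A.trace) (a b : Fin m → ℂ) :
    ∑ i, ∑ y, (K i *ᵥ a) y * star ((K i *ᵥ b) y) = ∑ x, a x * star (b x) := by
  have h := hE (Matrix.vecMulVec a (star b))
  rw [hK, Matrix.trace_sum] at h
  simp only [mul_vecMulVec_mul_conjTranspose] at h
  simpa [Matrix.trace, Matrix.vecMulVec_apply] using h

/-- Kraus operators of a channel that maps `ψ` to the pure state `φ` map `ψ` to multiples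
of `φ`. -/
theorem IsKraus.exists_mulVec_eq {m n r : ℕ} {E : Op m →ₗ[ℂ] Op n}
    {K : Fin r → Matrix (Fin n) (Fin m) ℂ} (hK : IsKraus E K)
    {ψ : EuclideanSpace ℂ (Fin m)} {φ : EuclideanSpace ℂ (Fin n)}
    (hφ : ‖φ‖ = 1) (h : E (proj ψ) = proj φ) :
    ∃ c : EuclideanSpace ℂ (Fin r), ‖c‖ = 1 ∧ ∀ i y, (K i *ᵥ ψ.ofLp) y = star (c i) * φ y := by
  obtain ⟨y₀, hy₀⟩ := exists_ne_zero_of_norm_eq_one hφ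
  obtain ⟨c, hc, hw⟩ := exists_unit_of_gram_rank_one
    (fun y => (WithLp.toLp 2 fun i => star ((K i *ᵥ ψ.ofLp) y) : EuclideanSpace ℂ (Fin r))) φ
    (fun y y' => by
      have h1 : E (proj ψ) y y' = φ y * star (φ y') := by rw [h]; rfl
      rw [← h1, hK, proj_eq_vecMulVec, Matrix.sum_apply, PiLp.inner_apply]
      simp only [mul_vecMulVec_mul_conjTranspose]
      refine Finset.sum_congr rfl fun i _ => ?_
      simp [Matrix.vecMulVec_apply, mul_comm]) hy₀
  refine ⟨c, hc, fun i y => ?_⟩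
  have h1 := congrArg (fun u : EuclideanSpace ℂ (Fin r) => star (u i)) (hw y)
  simpa [mul_comm] using h1

theorem IsIO.majorizedBy {m n : ℕ} {E : Op m →ₗ[ℂ] Op n} (hE : IsIO E)
    {ψ : EuclideanSpace ℂ (Fin m)} {φ : EuclideanSpace ℂ (Fin n)}
    (hψ : ‖ψ‖ = 1) (hφ : ‖φ‖ = 1) (h : E (proj ψ) = proj φ) :
    MajorizedBy (fun x => ‖ψ x‖ ^ 2) (fun y => ‖φ y‖ ^ 2) := by
  obtain ⟨r, K, hK, hinc⟩ := hE.incoherent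
  have hTP := hK.sum_mulVec hE.channel.tracePreserving
  obtain ⟨c, hc, hKψ⟩ := hK.exists_mulVec_eq hφ h
  have hcsum : ∑ i, ‖c i‖ ^ 2 = 1 := sum_norm_sq_eq_one hc
  -- Applied to |x⟩⟨x|, incoherence leaves at most one nonzero entry in column x.
  have hcol : ∀ i x y y', K i y x ≠ 0 → K i y' x ≠ 0 → y = y' := by
    intro i x y y' hy hy'
    by_contra hne
    have h1 := hinc i (Matrix.diagonal (Pi.single x 1)) (Matrix.isDiag_diagonal _) hne
    beta_reduce at h1
    rw [Matrix.mul_apply] at h1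
    simp only [Matrix.mul_diagonal, Matrix.conjTranspose_apply] at h1
    rw [Finset.sum_eq_single x (fun z _ hz => by simp [hz]) (by simp)] at h1
    simp [hy, hy'] at h1
  refine majorizedBy_of_weights (fun y => by positivity)
    (by rw [sum_norm_sq_eq_one hψ, sum_norm_sq_eq_one hφ]) fun S => ?_
  set T : Fin r → Finset (Fin n) := fun i =>
    S.biUnion fun x => Finset.univ.filter fun y => K i y x ≠ 0 with hT
  have hTcard : ∀ i, (T i).card ≤ S.card := by
    intro i
    refine (Finset.card_biUnion_le_card_mul _ _ 1 fun x _ => ?_).trans (by simp)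
    rw [Finset.card_le_one]
    intro y hy y' hy'
    exact hcol i x y y' (Finset.mem_filter.1 hy).2 (Finset.mem_filter.1 hy').2
  set w : Fin n → ℝ := fun y => ∑ i, if y ∈ T i then ‖c i‖ ^ 2 else 0 with hw
  have hw0 : ∀ y, 0 ≤ w y := fun y => Finset.sum_nonneg fun i _ => by split_ifs <;> positivity
  refine ⟨w, hw0, fun y => ?_, ?_, ?_⟩
  · rw [← hcsum]
    exact Finset.sum_le_sum fun i _ => by split_ifs <;> simp
  · rw [hw, Finset.sum_comm]
    calc ∑ i, ∑ y, (if y ∈ T i then ‖c i‖ ^ 2 else 0) = ∑ i, (T i).card * ‖c i‖ ^ 2 := by simp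
      _ ≤ ∑ i, (S.card : ℝ) * ‖c i‖ ^ 2 := Finset.sum_le_sum fun i _ =>
          mul_le_mul_of_nonneg_right (by exact_mod_cast hTcard i) (by positivity)
      _ = S.card := by rw [← Finset.mul_sum, hcsum, mul_one]
  set s := ∑ x ∈ S, ‖ψ x‖ ^ 2 with hs
  -- By the isometry property, s = ⟨ψ,a⟩ is a sum over i of ⟨Kᵢψ, Kᵢa⟩, and Kᵢa lives on Tᵢ.
  set a : Fin m → ℂ := fun x => if x ∈ S then ψ x else 0 with ha
  have hsupp : ∀ i y, y ∉ T i → (K i *ᵥ a) y = 0 := by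
    intro i y hy
    rw [Matrix.mulVec, dotProduct]
    refine Finset.sum_eq_zero fun x _ => ?_
    by_cases hx : x ∈ S
    · have : K i y x = 0 := by
        by_contra hne
        exact hy (Finset.mem_biUnion.2 ⟨x, hx, by simpa using hne⟩)
      rw [this, zero_mul]
    · simp [ha, hx]
  have h1 : ∑ i, ∑ y, ‖(K i *ᵥ a) y‖ ^ 2 = s := by
    have := hTP a a
    simp only [mul_star_eq_ofReal_norm_sq] at this
    rw [hs, ← Finset.univ_inter S, ← Finset.sum_ite_mem]
    have h2 : ∀ x, ‖a x‖ ^ 2 = if x ∈ S then ‖ψ x‖ ^ 2 else 0 := fun x => by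
      simp only [ha]; split_ifs <;> simp
    simp only [h2] at this
    exact_mod_cast this
  have h2 : s ≤ ∑ i, ∑ y, (if y ∈ T i then ‖c i‖ * ‖φ y‖ else 0) * ‖(K i *ᵥ a) y‖ := by
    have h3 := hTP a ψ.ofLp
    have h4 : ∑ x, a x * star (ψ x) = (s : ℂ) := by
      rw [hs, ← Finset.univ_inter S, ← Finset.sum_ite_mem, Complex.ofReal_sum]
      refine Finset.sum_congr rfl fun x _ => ?_
      simp only [ha]
      split_ifs
      · exact mul_star_eq_ofReal_norm_sq _
      · simp
    rw [h4] at h3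
    have h5 : s ≤ ‖(s : ℂ)‖ := by rw [Complex.norm_real]; exact le_abs_self s
    rw [← h3] at h5
    refine h5.trans ((norm_sum_le _ _).trans (Finset.sum_le_sum fun i _ =>
      (norm_sum_le _ _).trans (Finset.sum_le_sum fun y _ => le_of_eq ?_)))
    rw [norm_mul, norm_star, hKψ, norm_mul, norm_star]
    split_ifs with hy
    · ring
    · simp [hsupp i y hy]
  have h3 : s ^ 2 ≤ (∑ y, w y * ‖φ y‖ ^ 2) * s := by
    -- Cauchy–Schwarz over all pairs (i, y); the second factor is again s, which is then cancelled.
    have hcs := Finset.sum_mul_sq_le_sq_mul_sq (Finset.univ : Finset (Fin r × Fin n))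
      (fun z => if z.2 ∈ T z.1 then ‖c z.1‖ * ‖φ z.2‖ else 0) (fun z => ‖(K z.1 *ᵥ a) z.2‖)
    simp only [Fintype.sum_prod_type] at hcs
    rw [h1] at hcs
    have h4 : ∑ i, ∑ y, (if y ∈ T i then ‖c i‖ * ‖φ y‖ else 0) ^ 2 = ∑ y, w y * ‖φ y‖ ^ 2 := by
      rw [Finset.sum_comm]
      refine Finset.sum_congr rfl fun y _ => ?_
      rw [hw, Finset.sum_mul]
      refine Finset.sum_congr rfl fun i _ => ?_
      split_ifs
      · ring
      · simp
    rw [h4] at hcs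
    exact (pow_le_pow_left₀ (by positivity) h2 2).trans hcs
  have hW : 0 ≤ ∑ y, w y * ‖φ y‖ ^ 2 :=
    Finset.sum_nonneg fun y _ => mul_nonneg (hw0 y) (by positivity)
  rcases (show 0 ≤ s by positivity).eq_or_lt with h0 | hpos
  · rw [← h0]; exact hW
  · exact le_of_mul_le_mul_right (by rwa [sq] at h3) hpos

/-! ### Kraus maps and the strictly incoherent construction -/

/-- The completely positive map with Kraus operators `K`. -/
noncomputable def krausMap {m n : ℕ} {ι : Type*} [Fintype ι] (K : ι → Matrix (Fin n) (Fin m) ℂ) :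
    Op m →ₗ[ℂ] Op n where
  toFun A := ∑ i, K i * A * (K i)ᴴ
  map_add' A B := by simp only [Matrix.mul_add, Matrix.add_mul, Finset.sum_add_distrib]
  map_smul' c A := by simp [Finset.smul_sum]

theorem krausMap_apply {m n : ℕ} {ι : Type*} [Fintype ι] (K : ι → Matrix (Fin n) (Fin m) ℂ)
    (A : Op m) : krausMap K A = ∑ i, K i * A * (K i)ᴴ := rfl

/-- The ampliation has Kraus operators 1 ⊗ Kᵢ, so it is a sum of congruences. -/
theorem isCompletelyPositive_krausMap {m n : ℕ} {ι : Type*} [Fintype ι]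
    (K : ι → Matrix (Fin n) (Fin m) ℂ) : IsCompletelyPositive (krausMap K) := by
  intro k A hA
  have h : ampliation k (krausMap K) A =
      ∑ i, Matrix.kronecker (1 : Matrix (Fin k) (Fin k) ℂ) (K i) * A *
        (Matrix.kronecker (1 : Matrix (Fin k) (Fin k) ℂ) (K i))ᴴ := by
    ext a b
    simp only [ampliation, krausMap_apply, Matrix.of_apply, Matrix.sum_apply]
    refine Finset.sum_congr rfl fun i _ => ?_
    simp [Matrix.mul_apply, Fintype.sum_prod_type, Matrix.kroneckerMap_apply, Matrix.one_apply,
      Finset.sum_mul, apply_ite (starRingEnd ℂ), Finset.sum_ite_irrel]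
  rw [h]
  exact Matrix.posSemidef_sum _ fun i _ => hA.mul_mul_conjTranspose_same _

theorem isChannel_krausMap {m n : ℕ} {ι : Type*} [Fintype ι]
    (K : ι → Matrix (Fin n) (Fin m) ℂ) (h : ∑ i, (K i)ᴴ * K i = 1) :
    IsChannel (krausMap K) := by
  refine ⟨isCompletelyPositive_krausMap K, fun A => ?_⟩
  rw [krausMap_apply, Matrix.trace_sum]
  have hcyc : ∀ i, (K i * A * (K i)ᴴ).trace = ((K i)ᴴ * K i * A).trace := fun i => by
    rw [Matrix.trace_mul_comm, Matrix.mul_assoc]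
  simp only [hcyc]
  rw [← Matrix.trace_sum, ← Finset.sum_mul, h, one_mul]

theorem isKraus_krausMap {m n : ℕ} {ι : Type*} [Fintype ι] (K : ι → Matrix (Fin n) (Fin m) ℂ) :
    IsKraus (krausMap K) (K ∘ (Fintype.equivFin ι).symm) := fun A =>
  (Equiv.sum_comp (Fintype.equivFin ι).symm fun i => K i * A * (K i)ᴴ).symm

/-- An operator with at most one nonzero entry in each row and each column commutes with
dephasing. -/
theorem dephase_mul_mul_conjTranspose {m n : ℕ} (K : Matrix (Fin n) (Fin m) ℂ)
    (hrow : ∀ y x x', x ≠ x' → K y x * star (K y x') = 0)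
    (hcol : ∀ x y y', y ≠ y' → K y x * star (K y' x) = 0) (A : Op m) :
    dephase (K * A * Kᴴ) = K * dephase A * Kᴴ := by
  ext y y'
  have hR : (K * dephase A * Kᴴ) y y' = ∑ x, K y x * star (K y' x) * A x x := by
    rw [Matrix.mul_apply]
    refine Finset.sum_congr rfl fun x _ => ?_
    rw [dephase, Matrix.mul_diagonal, Matrix.conjTranspose_apply, Matrix.diag_apply]
    ring
  rw [hR]
  by_cases hy : y = y'
  · subst hy
    rw [dephase, Matrix.diagonal_apply_eq, Matrix.diag_apply, Matrix.mul_apply]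
    refine Finset.sum_congr rfl fun x _ => ?_
    rw [Matrix.mul_apply, Finset.sum_mul, Finset.sum_eq_single x]
    · rw [Matrix.conjTranspose_apply]
      ring
    · intro x' _ hx'
      rw [Matrix.conjTranspose_apply, mul_right_comm, hrow y x' x hx', zero_mul]
    · simp
  · rw [dephase, Matrix.diagonal_apply_ne _ hy]
    exact (Finset.sum_eq_zero fun x _ => by rw [hcol x y y' hy, zero_mul]).symm

theorem IsSIO.isIncoherentOperation {m n : ℕ} {E : Op m →ₗ[ℂ] Op n} (hE : IsSIO E) : IsIO E := by
  obtain ⟨r, K, hK, h⟩ := hE.strictlyIncoherent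
  refine ⟨hE.channel, r, K, hK, fun i A hA => ?_⟩
  have h1 : dephase A = A := hA.diagonal_diag
  have h2 := h i A
  rw [h1] at h2
  rw [← h2]
  exact Matrix.isDiag_diagonal _

theorem IsSIO.isDephasingCovariant {m n : ℕ} {E : Op m →ₗ[ℂ] Op n} (hE : IsSIO E) : IsDIO E := by
  obtain ⟨r, K, hK, h⟩ := hE.strictlyIncoherent
  refine ⟨hE.channel, fun A => ?_⟩
  have hsum : ∀ f : Fin r → Op n, dephase (∑ i, f i) = ∑ i, dephase (f i) := by
    intro f
    ext y y'
    by_cases hy : y = y'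
    · subst hy
      simp [dephase, Matrix.sum_apply]
    · simp [dephase, Matrix.sum_apply, Matrix.diagonal_apply_ne _ hy]
  rw [hK, hK, hsum]
  exact Finset.sum_congr rfl fun i _ => h i A

theorem exists_isSIO_of_majorizedBy {m n : ℕ}
    {ψ : EuclideanSpace ℂ (Fin m)} {φ : EuclideanSpace ℂ (Fin n)} (hφ : ‖φ‖ = 1)
    (h : MajorizedBy (fun x => ‖ψ x‖ ^ 2) (fun y => ‖φ y‖ ^ 2)) :
    ∃ E : Op m →ₗ[ℂ] Op n, IsSIO E ∧ E (proj ψ) = proj φ := by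
  obtain ⟨ι, _, l, σ, hl0, hl1, hp⟩ := h.exists_perm_combination
  obtain ⟨y₀, -⟩ := exists_ne_zero_of_norm_eq_one hφ
  have hm : m ≤ max m n := le_max_left m n
  have hn : n ≤ max m n := le_max_right m n
  -- Where ψ x = 0, division by zero makes column x vanish in the first family; the second family
  -- restores trace preservation by sending such x to `y₀`, and it annihilates ψ.
  set K : ι ⊕ Fin m → Matrix (Fin n) (Fin m) ℂ := Sum.elim
    (fun i => Matrix.of fun y x =>
      if σ i (Fin.castLE hm x) = Fin.castLE hn y then (Real.sqrt (l i) : ℂ) * (φ y / ψ x) else 0)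
    (fun z => Matrix.of fun y x => if x = z ∧ y = y₀ ∧ ψ z = 0 then 1 else 0) with hKdef
  have hrow : ∀ j y x x', x ≠ x' → K j y x * star (K j y x') = 0 := by
    rintro (i | z) y x x' hx
    · simp only [hKdef, Sum.elim_inl, Matrix.of_apply]
      split_ifs with h1 h2
      · exact absurd (Fin.castLE_injective hm ((σ i).injective (h1.trans h2.symm))) hx
      all_goals simp
    · simp only [hKdef, Sum.elim_inr, Matrix.of_apply]
      split_ifs with h1 h2
      · exact absurd (h1.1.trans h2.1.symm) hx
      all_goals simp
  have hcol : ∀ j x y y', y ≠ y' → K j y x * star (K j y' x) = 0 := by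
    rintro (i | z) x y y' hy
    · simp only [hKdef, Sum.elim_inl, Matrix.of_apply]
      split_ifs with h1 h2
      · exact absurd (Fin.castLE_injective hn (h1.symm.trans h2)) hy
      all_goals simp
    · simp only [hKdef, Sum.elim_inr, Matrix.of_apply]
      split_ifs with h1 h2
      · exact absurd (h1.2.1.trans h2.2.1.symm) hy
      all_goals simp
  have hnorm : ∀ i x, ∑ y, ‖K (Sum.inl i) y x‖ ^ 2 =
      l i * zeroPad (max m n) (fun y => ‖φ y‖ ^ 2) (σ i (Fin.castLE hm x)) / ‖ψ x‖ ^ 2 := by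
    intro i x
    have h1 := sum_mul_zeroPad hn (fun k => if σ i (Fin.castLE hm x) = k then 1 else 0)
      (fun y => ‖φ y‖ ^ 2)
    simp only [ite_mul, one_mul, zero_mul, Finset.sum_ite_eq, Finset.mem_univ, if_true] at h1
    rw [h1, Finset.mul_sum, Finset.sum_div]
    refine Finset.sum_congr rfl fun y _ => ?_
    simp only [hKdef, Sum.elim_inl, Matrix.of_apply]
    split_ifs
    · rw [norm_mul, norm_div, Complex.norm_real, mul_pow, div_pow, Real.norm_eq_abs, sq_abs,
        Real.sq_sqrt (hl0 i)]
      ring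
    · simp
  have hTP : ∑ j, (K j)ᴴ * K j = 1 := by
    ext x x'
    rw [Matrix.sum_apply]
    simp only [Matrix.mul_apply, Matrix.conjTranspose_apply]
    by_cases hx : x = x'
    · subst hx
      simp only [star_mul_eq_ofReal_norm_sq, Matrix.one_apply_eq, ← Complex.ofReal_sum]
      rw [← Complex.ofReal_one, Complex.ofReal_inj, Fintype.sum_sum_type]
      simp only [hnorm]
      rw [← Finset.sum_div, ← hp, zeroPad_castLE]
      have h2 : ∑ z, ∑ y, ‖K (Sum.inr z) y x‖ ^ 2 = if ψ x = 0 then 1 else 0 := by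
        rw [Finset.sum_eq_single x, Finset.sum_eq_single y₀]
        · simp only [hKdef, Sum.elim_inr, Matrix.of_apply, true_and]
          split_ifs <;> simp
        · intro y _ hy
          simp [hKdef, hy]
        · simp
        · intro z _ hz
          simp [hKdef, hz.symm]
        · simp
      rw [h2]
      split_ifs with h0
      · simp [h0]
      · rw [div_self (by simpa using h0), add_zero]
    · rw [Matrix.one_apply_ne hx]
      refine Finset.sum_eq_zero fun j _ => Finset.sum_eq_zero fun y _ => ?_
      rw [mul_comm]
      exact hrow j y x' x (Ne.symm hx)
  -- A zero of the padded p forces every nonnegative term lᵢ q(σᵢ ·) there to vanish. This covers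
  -- both ψ x = 0 and rows y whose preimage lies in the padding.
  have hvanish : ∀ i y, zeroPad (max m n) (fun x => ‖ψ x‖ ^ 2)
      ((σ i).symm (Fin.castLE hn y)) = 0 → (Real.sqrt (l i) : ℂ) * φ y = 0 := by
    intro i y h0
    rw [hp, Finset.sum_eq_zero_iff_of_nonneg fun k _ => mul_nonneg (hl0 k)
      (zeroPad_mem (s := Set.Ici 0) (by simp) (fun y => by simp) _)] at h0
    have h1 := h0 i (Finset.mem_univ i)
    rw [Equiv.apply_symm_apply, zeroPad_castLE] at h1
    rcases mul_eq_zero.1 h1 with h2 | h2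
    · simp [h2]
    · have : φ y = 0 := by simpa using h2
      simp [this]
  have hKψ : ∀ i, K (Sum.inl i) *ᵥ ψ.ofLp = (Real.sqrt (l i) : ℂ) • φ.ofLp := by
    intro i
    ext y
    rw [Pi.smul_apply, smul_eq_mul]
    simp only [Matrix.mulVec, dotProduct, hKdef, Sum.elim_inl, Matrix.of_apply, ite_mul, zero_mul]
    by_cases hX : ∃ x, σ i (Fin.castLE hm x) = Fin.castLE hn y
    · obtain ⟨x, hx⟩ := hX
      rw [Finset.sum_eq_single x, if_pos hx]
      · by_cases h0 : ψ x = 0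
        · rw [hvanish i y, h0, mul_zero]
          rw [← hx, Equiv.symm_apply_apply, zeroPad_castLE, h0]
          simp
        · rw [mul_assoc, div_mul_cancel₀ _ h0]
      · intro x' _ hx'
        refine if_neg fun h1 => hx' ?_
        exact Fin.castLE_injective hm ((σ i).injective (h1.trans hx.symm))
      · simp
    · rw [hvanish i y]
      · exact Finset.sum_eq_zero fun x _ => if_neg fun h1 => hX ⟨x, h1⟩
      · have : ¬ ((σ i).symm (Fin.castLE hn y) : ℕ) < m := fun hlt =>
          hX ⟨⟨_, hlt⟩, (Equiv.eq_symm_apply _).1 rfl⟩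
        simp [zeroPad, this]
  have hKz : ∀ z, K (Sum.inr z) *ᵥ ψ.ofLp = 0 := by
    intro z
    ext y
    rw [Matrix.mulVec, dotProduct]
    refine Finset.sum_eq_zero fun x _ => ?_
    simp only [hKdef, Sum.elim_inr, Matrix.of_apply]
    split_ifs with h1
    · rw [h1.1, h1.2.2, mul_zero]
    · rw [zero_mul]
  refine ⟨krausMap K, ⟨isChannel_krausMap K hTP, _, _, isKraus_krausMap K, fun i A =>
    dephase_mul_mul_conjTranspose _ (hrow _) (hcol _) A⟩, ?_⟩
  rw [krausMap_apply, proj_eq_vecMulVec, proj_eq_vecMulVec]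
  simp only [mul_vecMulVec_mul_conjTranspose, Fintype.sum_sum_type, hKψ, hKz]
  ext y y'
  have h1 : ∑ i, (Real.sqrt (l i) : ℂ) * Real.sqrt (l i) = 1 := by
    simp only [← Complex.ofReal_mul, Real.mul_self_sqrt (hl0 _)]
    rw [← Complex.ofReal_sum, hl1, Complex.ofReal_one]
  calc _ = ∑ i, ((Real.sqrt (l i) : ℂ) * Real.sqrt (l i)) * (φ y * star (φ y')) := by
        simp only [Matrix.add_apply, Matrix.sum_apply, Matrix.vecMulVec_apply]
        simp [mul_mul_mul_comm]
    _ = _ := by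
        rw [← Finset.sum_mul, h1, one_mul]
        rfl

end Coherence

theorem theorem1 {dIn dOut : ℕ}
    (ψ : EuclideanSpace ℂ (Fin dIn)) (φ : EuclideanSpace ℂ (Fin dOut))
    (hψ : ‖ψ‖ = 1) (hφ : ‖φ‖ = 1) :
    ((∃ E : Coherence.Op dIn →ₗ[ℂ] Coherence.Op dOut, Coherence.IsDIO E ∧ E (Coherence.proj ψ) = Coherence.proj φ) ↔
      Coherence.MajorizedBy (fun x => ‖ψ x‖ ^ 2) (fun y => ‖φ y‖ ^ 2)) ∧
    ((∃ E : Coherence.Op dIn →ₗ[ℂ] Coherence.Op dOut, Coherence.IsIO E ∧ E (Coherence.proj ψ) = Coherence.proj φ) ↔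
      Coherence.MajorizedBy (fun x => ‖ψ x‖ ^ 2) (fun y => ‖φ y‖ ^ 2)) ∧
    ((∃ E : Coherence.Op dIn →ₗ[ℂ] Coherence.Op dOut, Coherence.IsSIO E ∧ E (Coherence.proj ψ) = Coherence.proj φ) ↔
      Coherence.MajorizedBy (fun x => ‖ψ x‖ ^ 2) (fun y => ‖φ y‖ ^ 2)) := by
  exact ⟨⟨fun ⟨_, hE, h⟩ => hE.majorizedBy hφ h, fun h =>
      let ⟨E, hE, hEψ⟩ := Coherence.exists_isSIO_of_majorizedBy hφ h
      ⟨E, hE.isDephasingCovariant, hEψ⟩⟩,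
    ⟨fun ⟨_, hE, h⟩ => hE.majorizedBy hψ hφ h, fun h =>
      let ⟨E, hE, hEψ⟩ := Coherence.exists_isSIO_of_majorizedBy hφ h
      ⟨E, hE.isIncoherentOperation, hEψ⟩⟩,
    ⟨fun ⟨_, hE, h⟩ => hE.isIncoherentOperation.majorizedBy hψ hφ h, Coherence.exists_isSIO_of_majorizedBy hφ⟩⟩
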